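/- Let $k$ be an algebraically closed field, let $R=\bigoplus_{i\in\mathbb Z}R_i$ be a $\mathbb Z$-graded associative unital $k$-algebra that is finitely generated as a $k$-algebra, and let $M$ be a finite-dimensional (ungraded) left $R$-module, $d=\dim_k M$. Call $M$ \emph{gradable} if there is a decomposition of vector spaces $M=\bigoplus_{j\in\mathbb Z}M_j$ with $R_iM_j\subseteq M_{i+j}$ for all $i,j\in\mathbb Z$. The \emph{variety of $d$-dimensional $R$-modules} is the set of all $k$-algebra homomorphisms $\rho\colon R\to \mathrm{Mat}_{d}(k)$ with the Zariski topology (given by the matrix entries of $\rho(r_1),\dots,\rho(r_n)$ for generators $r_1,\dots,r_n$ of $R$; it does not depend on the choice of generators), and $\mathrm{GL}_d(k)$ acts on it by $(g\cdot\rho)(r)=g\rho(r)g^{-1}$. We say that $M$ \emph{has an open orbit} if the $\mathrm{GL}_d(k)$-orbit of the point given by $M$ and a $k$-basis of $M$ is open in this variety. Then: \begin{enumerate} \item if $M$ has an open orbit, then $M$ is gradable; \item if $\operatorname{Ext}^1_R(M,M)=0$, then $M$ is gradable. \end{enumerate} -/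

import Mathlib

open CategoryTheory

universe u v w

/-- The Zariski topology on the affine space `k^σ`: the basic open sets are the
non-vanishing loci of polynomials. -/
@[reducible] def zariskiTopology (k σ : Type*) [Field k] : TopologicalSpace (σ → k) :=
  TopologicalSpace.generateFrom
    {U | ∃ p : MvPolynomial σ k, U = {x | MvPolynomial.eval x p ≠ 0}}

/-- The variety of `d`-dimensional `R`-modules: its points are the `R`-module structures on
`k^d`, that is, the `k`-algebra homomorphisms from `R` to the `d × d` matrices over `k`. -/
structure ModuleVariety (k R : Type*) [Field k] [Ring R] [Algebra k R] (d : ℕ) where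
  /-- The representation of `R` on `k^d` given by the point. -/
  rep : R →ₐ[k] Matrix (Fin d) (Fin d) k

namespace ModuleVariety

variable {k R : Type*} [Field k] [Ring R] [Algebra k R] {d : ℕ}

/-- The matrix entries of the action of all elements of `R`. -/
def coords (x : ModuleVariety k R d) : R × Fin d × Fin d → k :=
  fun e => x.rep e.1 e.2.1 e.2.2

/-- The matrix entries of the action of the members of a family `s` in `R`. When `s` is a
finite family of generators of `R`, this is the usual embedding of the module variety as a
closed subset of affine space. -/
def coordsOf {ι : Type*} (s : ι → R) (x : ModuleVariety k R d) : ι × Fin d × Fin d → k :=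
  fun e => x.rep (s e.1) e.2.1 e.2.2

/-- The Zariski topology on the module variety, without a choice of generators. By
`topology_eq_induced` it is the one given by the matrix entries of any family of generators. -/
instance : TopologicalSpace (ModuleVariety k R d) :=
  (zariskiTopology k (R × Fin d × Fin d)).induced coords

/-- The action of `GL_d(k)` on the module variety by base change, `(g • ρ)(r) = g ρ(r) g⁻¹`. -/
instance : MulAction (GL (Fin d) k) (ModuleVariety k R d) where
  smul g x :=
    { rep :=
        { toFun := fun r =>
            (g : Matrix (Fin d) (Fin d) k) * x.rep r *
              ((g⁻¹ : GL (Fin d) k) : Matrix (Fin d) (Fin d) k)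
          map_one' := by simp
          map_mul' := fun a b => by
            simp only [map_mul, mul_assoc, Units.inv_mul_cancel_left]
          map_zero' := by simp
          map_add' := fun a b => by simp only [map_add, mul_add, add_mul]
          commutes' := fun c => by
            rw [AlgHom.commutes, ← Algebra.commutes, mul_assoc, Units.mul_inv, mul_one] } }
  one_smul x := by
    obtain ⟨f⟩ := x
    change ModuleVariety.mk _ = _
    congr 1
    ext1 r
    change (1 : Matrix (Fin d) (Fin d) k) * f r * _ = _
    simp
  mul_smul g h x := by
    change ModuleVariety.mk _ = ModuleVariety.mk _
    congr 1
    ext1 r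
    change ((g * h : GL (Fin d) k) : Matrix (Fin d) (Fin d) k) * x.rep r *
      (((g * h)⁻¹ : GL (Fin d) k) : Matrix (Fin d) (Fin d) k) =
      (g : Matrix (Fin d) (Fin d) k) * ((h : Matrix (Fin d) (Fin d) k) * x.rep r *
        ((h⁻¹ : GL (Fin d) k) : Matrix (Fin d) (Fin d) k)) *
        ((g⁻¹ : GL (Fin d) k) : Matrix (Fin d) (Fin d) k)
    rw [mul_inv_rev, Units.val_mul, Units.val_mul]
    simp only [mul_assoc]

/-- The topology of the module variety is the Zariski topology given by the matrix entries of
any family that generates `R`. -/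
theorem topology_eq_induced {ι : Type*} (s : ι → R)
    (hs : Algebra.adjoin k (Set.range s) = ⊤) :
    (inferInstance : TopologicalSpace (ModuleVariety k R d)) =
      (zariskiTopology k (ι × Fin d × Fin d)).induced (coordsOf s) := by
  have key : ∀ r : R, ∀ a b : Fin d, ∃ p : MvPolynomial (ι × Fin d × Fin d) k,
      ∀ x : ModuleVariety k R d, MvPolynomial.eval (coordsOf s x) p = x.rep r a b := by
    intro r
    have hr : r ∈ Algebra.adjoin k (Set.range s) := hs ▸ Algebra.mem_top
    induction hr using Algebra.adjoin_induction with
    | mem r h =>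
      obtain ⟨i, rfl⟩ := h
      exact fun a b => ⟨MvPolynomial.X (i, a, b), fun x => by simp [coordsOf]⟩
    | algebraMap c =>
      intro a b
      refine ⟨MvPolynomial.C (algebraMap k (Matrix (Fin d) (Fin d) k) c a b), fun x => ?_⟩
      rw [MvPolynomial.eval_C, AlgHom.commutes]
    | add r t _ _ h₁ h₂ =>
      intro a b
      obtain ⟨p, hp⟩ := h₁ a b
      obtain ⟨q, hq⟩ := h₂ a b
      exact ⟨p + q, fun x => by simp [hp, hq]⟩
    | mul r t _ _ h₁ h₂ =>
      intro a b
      choose p hp using h₁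
      choose q hq using h₂
      exact ⟨∑ c, p a c * q c b, fun x => by simp [hp, hq, Matrix.mul_apply]⟩
  choose P hP using key
  change (zariskiTopology k (R × Fin d × Fin d)).induced coords = _
  unfold zariskiTopology
  rw [induced_generateFrom_eq, induced_generateFrom_eq]
  congr 1
  ext U
  constructor
  · rintro ⟨_, ⟨p, rfl⟩, rfl⟩
    refine ⟨_, ⟨MvPolynomial.bind₁ (fun e => P e.1 e.2.1 e.2.2) p, rfl⟩, ?_⟩
    ext x
    have h : (fun e : R × Fin d × Fin d =>
        MvPolynomial.eval (coordsOf s x) (P e.1 e.2.1 e.2.2)) = coords x :=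
      funext fun e => hP _ _ _ x
    simp only [Set.mem_preimage, Set.mem_ofPred_eq]
    rw [MvPolynomial.eval, MvPolynomial.eval₂Hom_bind₁]
    exact not_congr (by rw [← h]; rfl)
  · rintro ⟨_, ⟨p, rfl⟩, rfl⟩
    refine ⟨_, ⟨MvPolynomial.rename (fun e => (s e.1, e.2)) p, rfl⟩, ?_⟩
    ext x
    simp only [Set.mem_preimage, Set.mem_ofPred_eq, MvPolynomial.eval_rename]
    rfl

end ModuleVariety

/-- The point of the variety of `(dim M)`-dimensional `R`-modules given by `M` and a basis
of `M`. The orbit of this point does not depend on the basis. -/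
noncomputable def modulePoint (k R M : Type*) [Field k] [Ring R] [Algebra k R] [AddCommGroup M]
    [Module k M] [Module R M] [IsScalarTower k R M] [FiniteDimensional k M] :
    ModuleVariety k R (Module.finrank k M) :=
  ⟨((LinearMap.toMatrixAlgEquiv (Module.finBasis k M)).toAlgHom).comp (Algebra.lsmul k k M)⟩

/-- `M` has an open orbit: the `GL`-orbit of `M` is open in the variety of
`(dim M)`-dimensional `R`-modules. -/
def HasOpenOrbit (k R M : Type*) [Field k] [Ring R] [Algebra k R] [AddCommGroup M]
    [Module k M] [Module R M] [IsScalarTower k R M] [FiniteDimensional k M] : Prop :=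
  IsOpen (MulAction.orbit (GL (Fin (Module.finrank k M)) k) (modulePoint k R M))

/-- `M` is gradable: it is the underlying module of a `ℤ`-graded module over the `ℤ`-graded
algebra `R = ⨁ 𝒜 i`. -/
def IsGradable {k R : Type*} [Field k] [Ring R] [Algebra k R] (𝒜 : ℤ → Submodule k R)
    (M : Type*) [AddCommGroup M] [Module k M] [Module R M] : Prop :=
  ∃ ℳ : ℤ → Submodule k M, DirectSum.IsInternal ℳ ∧
    ∀ (i j : ℤ) (r : R) (m : M), r ∈ 𝒜 i → m ∈ ℳ j → r • m ∈ ℳ (i + j)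

/-!
`M` is gradable as soon as, for some unit `t` of `k` that is not a root of unity of small order,
there is an isomorphism `g` from `M` to its twist by `t`, in which `r ∈ 𝒜 i` acts as `t ^ i • r`.
Indeed `r ∈ 𝒜 i` maps the generalized eigenspace of `g` at `μ` to the one at `t ^ i * μ`. As `g`
has finitely many eigenvalues and `R` is generated in finitely many degrees, the eigenvalues on a
`t`-orbit fall into clusters separated by gaps that no generator jumps over; the position of an
eigenvalue relative to the preceding gap is the degree.

If the orbit of `M` is open, it contains the twist by all but finitely many `t`, since the twists
form a curve through `M`. If `Ext¹(M, M) = 0`, then every derivation from `R` to `End M` is inner,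
so the twist by `1 + X` is a trivial formal deformation of `M` over `k⟦X⟧`. The entries of the
isomorphism and of its inverse, with `1 + X` and its inverse, lie in a finitely generated
subalgebra of `k⟦X⟧`, which by the Nullstellensatz has a homomorphism to `k` under which `1 + X`
avoids the roots of unity of small order.
-/

section Gap

variable {G X : Type*} [Group G] [MulAction G X] {t : G} {S : Finset X} {N : ℕ} {x : X}

/-- Walking backwards from `x` along its `t`-orbit, the `N` steps that follow step `m` all miss the
set `S`. Such gaps cut the orbit into pieces on which the position along the orbit is a well-defined
integer. -/
def IsOrbitGap (t : G) (S : Finset X) (N : ℕ) (x : X) (m : ℤ) : Prop :=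
  ∀ j ∈ Set.Ioc m (m + N), t ^ (-j) • x ∉ S

theorem isOrbitGap_zpow_smul (n m : ℤ) :
    IsOrbitGap t S N (t ^ n • x) m ↔ IsOrbitGap t S N x (m - n) := by
  simp only [IsOrbitGap, Set.mem_Ioc, smul_smul, ← zpow_add]
  refine ⟨fun h j hj => ?_, fun h j hj => ?_⟩
  · convert h (j + n) (by omega) using 4
    ring
  · convert h (j - n) (by omega) using 4
    ring

theorem exists_isOrbitGap
    (ht : ∀ y ∈ S, ∀ n, 0 < n → n ≤ (S.card + 1) * N → t ^ n • y ≠ y) (x : X) :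
    ∃ m : ℕ, IsOrbitGap t S N x m := by
  by_contra! hgap
  have hmeet : ∀ q : ℕ, ∃ j : ℕ, q * N < j ∧ j ≤ (q + 1) * N ∧ t ^ (-(j : ℤ)) • x ∈ S := by
    intro q
    obtain ⟨j, hj, hjS⟩ : ∃ j ∈ Set.Ioc ((q * N : ℕ) : ℤ) ((q * N : ℕ) + N), t ^ (-j) • x ∈ S := by
      simpa only [IsOrbitGap, not_forall, not_not, exists_prop] using hgap (q * N)
    lift j to ℕ using (Nat.cast_nonneg _).trans hj.1.le
    exact ⟨j, by exact_mod_cast hj.1, by rw [add_one_mul]; exact_mod_cast hj.2, hjS⟩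
  choose j hj_gt hj_le hjS using hmeet
  have hcollision : ∃ p q, p < q ∧ q ≤ S.card ∧ t ^ (-(j p : ℤ)) • x = t ^ (-(j q : ℤ)) • x := by
    obtain ⟨p, hp, q, hq, hpq, h⟩ := Finset.exists_ne_map_eq_of_card_lt_of_maps_to
      (s := Finset.range (S.card + 1)) (by simp) (fun q _ => hjS q)
    rw [Finset.mem_range, Nat.lt_succ_iff] at hp hq
    rcases hpq.lt_or_gt with hlt | hlt
    exacts [⟨p, q, hlt, hq, h⟩, ⟨q, p, hlt, hp, h.symm⟩]
  obtain ⟨p, q, hpq, hq, h⟩ := hcollision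
  have hlt : j p < j q :=
    (hj_le p).trans_lt ((Nat.mul_le_mul_right N (Nat.succ_le_of_lt hpq)).trans_lt (hj_gt q))
  have hle : j q ≤ (S.card + 1) * N := (hj_le q).trans (by gcongr)
  refine ht _ (hjS q) (j q - j p) (by omega) (by omega) ?_
  rw [smul_smul, ← zpow_natCast, ← zpow_add, Nat.cast_sub hlt.le, ← h]
  ring_nf

theorem exists_orbit_position
    (ht : ∀ y ∈ S, ∀ n, 0 < n → n ≤ (S.card + 1) * N → t ^ n • y ≠ y) :
    ∃ φ : X → ℤ, ∀ x ∈ S, ∀ i : ℤ, |i| ≤ N → t ^ i • x ∈ S → φ (t ^ i • x) = φ x + i := by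
  classical
  have hgap := exists_isOrbitGap ht
  let φ : X → ℤ := fun x => Nat.find (hgap x)
  have forward : ∀ x ∈ S, ∀ n : ℕ, n ≤ N → φ (t ^ (n : ℤ) • x) = φ x + n := by
    intro x hx n hn
    suffices Nat.find (hgap (t ^ (n : ℤ) • x)) = Nat.find (hgap x) + n from
      (congrArg Nat.cast this).trans (Nat.cast_add _ _)
    refine (Nat.find_eq_iff _).mpr ⟨?_, fun m hm hmgap => ?_⟩
    · simpa only [isOrbitGap_zpow_smul, Nat.cast_add, add_sub_cancel_right]
        using Nat.find_spec (hgap x)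
    · have hnm : n ≤ m := by
        by_contra! hmn
        exact hmgap n ⟨by omega, by omega⟩ (by simpa only [zpow_neg, inv_smul_smul] using hx)
      rw [isOrbitGap_zpow_smul, ← Nat.cast_sub hnm] at hmgap
      exact Nat.find_min (hgap x) (by omega) hmgap
  refine ⟨φ, fun x hx i hi hix => ?_⟩
  obtain ⟨n, rfl | rfl⟩ := i.eq_nat_or_neg
  · exact forward x hx n (by simpa using hi)
  · have := forward _ hix n (by simpa using hi)
    rw [smul_smul, ← zpow_add, add_neg_cancel, zpow_zero, one_smul] at this
    omega

end Gap

section Generators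

variable {ι k R M : Type*} [DecidableEq ι] [AddMonoid ι] [CommRing k] [Ring R] [Algebra k R]
  (𝒜 : ι → Submodule k R) [GradedAlgebra 𝒜]

theorem smul_mem_of_generators [AddCommGroup M] [Module k M] [Module R M] [IsScalarTower k R M]
    {s : Set R} (hs : Algebra.adjoin k s = ⊤) (ℳ : ι → Submodule k M)
    (h : ∀ r ∈ s, ∀ i j, ∀ m ∈ ℳ j, (DirectSum.decompose 𝒜 r i : R) • m ∈ ℳ (i + j))
    (i j : ι) (r : R) (m : M) (hr : r ∈ 𝒜 i) (hm : m ∈ ℳ j) : r • m ∈ ℳ (i + j) := by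
  suffices ∀ r : R, ∀ i j, ∀ m ∈ ℳ j, (DirectSum.decompose 𝒜 r i : R) • m ∈ ℳ (i + j) by
    simpa only [DirectSum.decompose_of_mem_same 𝒜 hr] using this r i j m hm
  intro r
  have hr : r ∈ Algebra.adjoin k s := hs ▸ Algebra.mem_top
  induction hr using Algebra.adjoin_induction with
  | mem r hr => exact h r hr
  | algebraMap c =>
    intro i j m hm
    have hc : algebraMap k R c ∈ 𝒜 0 := SetLike.algebraMap_mem_graded 𝒜 c
    rcases eq_or_ne 0 i with rfl | hi
    · rw [DirectSum.decompose_of_mem_same 𝒜 hc, algebraMap_smul, zero_add]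
      exact (ℳ j).smul_mem c hm
    · rw [DirectSum.decompose_of_mem_ne 𝒜 hc hi, zero_smul]
      exact zero_mem _
  | add r t _ _ hr ht =>
    intro i j m hm
    rw [DirectSum.decompose_add, DirectSum.add_apply, Submodule.coe_add, add_smul]
    exact add_mem (hr i j m hm) (ht i j m hm)
  | mul r t _ _ hr ht =>
    intro i j m hm
    classical
    rw [DirectSum.decompose_mul, DirectSum.coe_mul_apply, Finset.sum_smul]
    refine sum_mem fun e he => ?_
    rw [mul_smul, ← (Finset.mem_filter.mp he).2, add_assoc]
    exact hr _ _ _ (ht _ _ _ hm)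

end Generators

theorem exists_degree_bound {R σ : Type*} [AddCommMonoid R] [SetLike σ R] [AddSubmonoidClass σ R]
    (𝒜 : ℤ → σ) [DirectSum.Decomposition 𝒜] (s : Finset R) :
    ∃ N : ℕ, ∀ r ∈ s, ∀ i : ℤ, (DirectSum.decompose 𝒜 r i : R) ≠ 0 → |i| ≤ N := by
  classical
  refine ⟨s.sup fun r => (DirectSum.decompose 𝒜 r).support.sup Int.natAbs, fun r hr i hi => ?_⟩
  have hi : i ∈ (DirectSum.decompose 𝒜 r).support :=
    DFinsupp.mem_support_iff.mpr fun h => hi (by rw [h, ZeroMemClass.coe_zero])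
  rw [Int.abs_eq_natAbs, Nat.cast_le]
  exact (Finset.le_sup (f := Int.natAbs) hi).trans
    (Finset.le_sup (f := fun r => (DirectSum.decompose 𝒜 r).support.sup Int.natAbs) hr)

section Eigenspaces

theorem mapsTo_maxGenEigenspace_of_mul_eq_smul_mul {k M : Type*} [CommRing k] [AddCommGroup M]
    [Module k M] {g f : Module.End k M} {c : k} (h : g * f = c • (f * g)) (μ : k) :
    Set.MapsTo f (g.maxGenEigenspace μ) (g.maxGenEigenspace (c * μ)) := by
  intro m hm
  obtain ⟨n, hn⟩ := (Module.End.mem_maxGenEigenspace _ _ _).mp hm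
  have hconj : SemiconjBy f (c • (g - μ • 1)) (g - (c * μ) • 1) := by
    rw [SemiconjBy, mul_smul_comm, sub_mul, h, mul_sub, smul_mul_assoc, mul_smul_comm, one_mul,
      mul_one, smul_sub, mul_smul]
  refine (Module.End.mem_maxGenEigenspace _ _ _).mpr ⟨n, ?_⟩
  rw [← Module.End.mul_apply, ← (hconj.pow_right n).eq, smul_pow, mul_smul_comm,
    LinearMap.smul_apply, Module.End.mul_apply, hn, map_zero, smul_zero]

variable {k M : Type*} [Field k] [AddCommGroup M] [Module k M] [FiniteDimensional k M]

theorem maxGenEigenspace_ne_bot_iff_mem_charpoly_roots {g : Module.End k M} {μ : k} :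
    g.maxGenEigenspace μ ≠ ⊥ ↔ μ ∈ g.charpoly.roots := by
  rw [Polynomial.mem_roots g.charpoly_monic.ne_zero,
    ← Module.End.hasEigenvalue_iff_isRoot_charpoly]
  exact Module.End.hasUnifEigenvalue_iff_hasUnifEigenvalue_one (k := ⊤) (by simp)

theorem isInternal_iSup_maxGenEigenspace_fiber [IsAlgClosed k] {ι : Type*} [DecidableEq ι]
    (g : Module.End k M) (φ : k → ι) :
    DirectSum.IsInternal fun j => ⨆ μ ∈ φ ⁻¹' {j}, g.maxGenEigenspace μ := by
  refine (DirectSum.isInternal_submodule_iff_iSupIndep_and_iSup_eq_top _).mpr ⟨fun j => ?_, ?_⟩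
  · have hdisj : Disjoint (φ ⁻¹' {j}) (φ ⁻¹' {j}ᶜ) := disjoint_compl_right.preimage φ
    refine (g.independent_maxGenEigenspace.disjoint_biSup_biSup hdisj).mono_right ?_
    exact iSup₂_le fun i hij => biSup_mono fun μ hμ => (Set.mem_singleton_iff.mp hμ).trans_ne hij
  · refine top_unique (g.iSup_maxGenEigenspace_eq_top.ge.trans (iSup_le fun μ => ?_))
    have hμ : g.maxGenEigenspace μ ≤ ⨆ ν ∈ φ ⁻¹' {φ μ}, g.maxGenEigenspace ν :=
      le_iSup₂_of_le μ (Set.mem_singleton (φ μ)) le_rfl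
    exact le_iSup_of_le (φ μ) hμ

theorem exists_eigenvalue_position {t : kˣ} {N : ℕ}
    (ht : ∀ n, 0 < n → n ≤ (Module.finrank k M + 1) * N → t ^ n ≠ 1) (g : (Module.End k M)ˣ) :
    ∃ φ : k → ℤ, ∀ (i : ℤ) (μ : k), |i| ≤ N → g.val.maxGenEigenspace μ ≠ ⊥ →
      g.val.maxGenEigenspace (t ^ i • μ) ≠ ⊥ → φ (t ^ i • μ) = φ μ + i := by
  classical
  let S : Finset k := g.val.charpoly.roots.toFinset
  have hS {μ : k} : μ ∈ S ↔ g.val.maxGenEigenspace μ ≠ ⊥ :=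
    Multiset.mem_toFinset.trans maxGenEigenspace_ne_bot_iff_mem_charpoly_roots.symm
  have hcard : S.card ≤ Module.finrank k M :=
    (Multiset.toFinset_card_le _).trans ((Polynomial.card_roots' _).trans
      (LinearMap.charpoly_natDegree _).le)
  have hS0 : ∀ μ ∈ S, μ ≠ 0 := by
    rintro μ hμ rfl
    have h0 := Polynomial.isRoot_of_mem_roots (Multiset.mem_toFinset.mp hμ)
    rw [← Module.End.hasEigenvalue_iff_isRoot_charpoly,
      Module.End.hasEigenvalue_iff_mem_spectrum] at h0
    exact spectrum.zero_notMem k g.isUnit h0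
  have hfree : ∀ μ ∈ S, ∀ n, 0 < n → n ≤ (S.card + 1) * N → t ^ n • μ ≠ μ := by
    intro μ hμ n hn hnL htμ
    refine ht n hn (hnL.trans (by gcongr)) (Units.ext (mul_right_cancel₀ (hS0 μ hμ) ?_))
    rwa [Units.val_one, one_mul]
  obtain ⟨φ, hφ⟩ := exists_orbit_position hfree
  exact ⟨φ, fun i μ hi hμ hμi => hφ μ (hS.mpr hμ) i hi (hS.mpr hμi)⟩

end Eigenspaces

section Twist

variable {k R S S' B B' : Type*} [CommRing k] [Ring R] [Algebra k R] {𝒜 : ℤ → Submodule k R}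
  [CommRing S] [Ring B] [Algebra k B] [Algebra S B] [CommRing S'] [Ring B'] [Algebra k B']
  [Algebra S' B'] {φ : S →* S'} {f : B →ₐ[k] B'} {t : Sˣ} {σ : R →ₐ[k] B} {g : B}

/-- `g` carries the representation `σ` to its twist by `t`: it commutes with the elements of degree
`i` up to the factor `t ^ i`. -/
def IsTwistIntertwiner (𝒜 : ℤ → Submodule k R) (t : Sˣ) (σ : R →ₐ[k] B) (g : B) : Prop :=
  ∀ ⦃i : ℤ⦄ ⦃r : R⦄, r ∈ 𝒜 i → g * σ r = (t ^ i).val • (σ r * g)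

theorem IsTwistIntertwiner.map (h : IsTwistIntertwiner 𝒜 t σ g)
    (hf : ∀ s b, f (s • b) = φ s • f b) :
    IsTwistIntertwiner 𝒜 (Units.map φ t) (f.comp σ) (f g) :=
  fun i r hr => by
    rw [AlgHom.comp_apply, ← map_zpow, Units.coe_map, ← map_mul, ← map_mul, h hr, hf]

theorem IsTwistIntertwiner.of_map (h : IsTwistIntertwiner 𝒜 (Units.map φ t) (f.comp σ) (f g))
    (hf : ∀ s b, f (s • b) = φ s • f b) (hinj : Function.Injective f) :
    IsTwistIntertwiner 𝒜 t σ g :=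
  fun i r hr => hinj (by
    rw [hf, map_mul, map_mul, ← Units.coe_map, map_zpow]
    exact h hr)

variable [Algebra k S] [IsScalarTower k S B] [Algebra k S'] [IsScalarTower k S' B'] (𝒜)
  [GradedAlgebra 𝒜]

/-- The representation `σ` twisted by the unit `t`: the elements of degree `i` act through `σ`
multiplied by `t ^ i`. -/
noncomputable def gradedTwist (t : Sˣ) (σ : R →ₐ[k] B) : R →ₐ[k] B :=
  (DirectSum.toAlgebra k (fun i => 𝒜 i) (fun i => (t ^ i).val • σ.toLinearMap ∘ₗ (𝒜 i).subtype)
    (by simp) (fun {i j} r s => by simp [zpow_add, mul_comm (t ^ i).val, mul_smul])).comp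
  (DirectSum.decomposeAlgEquiv 𝒜).toAlgHom

theorem gradedTwist_of_mem (t : Sˣ) (σ : R →ₐ[k] B) {i : ℤ} {r : R}
    (hr : r ∈ 𝒜 i) : gradedTwist 𝒜 t σ r = (t ^ i).val • σ r := by
  lift r to 𝒜 i using hr
  simp only [gradedTwist, AlgHom.coe_comp, AlgEquiv.coe_toAlgHom, Function.comp_apply,
    DirectSum.decomposeAlgEquiv_apply, DirectSum.decompose_coe, DirectSum.toAlgebra_apply]
  exact DirectSum.toSemiring_of (A := fun i => 𝒜 i) _ _ _ i r

theorem algHom_ext_of_homogeneous {σ τ : R →ₐ[k] B}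
    (h : ∀ i, ∀ r ∈ 𝒜 i, σ r = τ r) : σ = τ :=
  AlgHom.toLinearMap_injective (DirectSum.decompose_lhom_ext 𝒜 fun i =>
    LinearMap.ext fun r => h i r r.2)

theorem gradedTwist_one (σ : R →ₐ[k] B) : gradedTwist 𝒜 (1 : Sˣ) σ = σ :=
  algHom_ext_of_homogeneous 𝒜 fun i r hr => by simp [gradedTwist_of_mem 𝒜 _ _ hr]

theorem comp_gradedTwist (hf : ∀ s b, f (s • b) = φ s • f b) :
    f.comp (gradedTwist 𝒜 t σ) = gradedTwist 𝒜 (Units.map φ t) (f.comp σ) :=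
  algHom_ext_of_homogeneous 𝒜 fun i r hr => by
    simp only [AlgHom.comp_apply, gradedTwist_of_mem 𝒜 _ _ hr, hf, ← map_zpow, Units.coe_map]

variable {𝒜}

theorem isTwistIntertwiner_of_gradedTwist (h : ∀ r, g * σ r = gradedTwist 𝒜 t σ r * g) :
    IsTwistIntertwiner 𝒜 t σ g :=
  fun i r hr => by rw [h, gradedTwist_of_mem 𝒜 _ _ hr, smul_mul_assoc]

end Twist

section BaseChange

variable {k R S n : Type*} [CommRing k] [Ring R] [Algebra k R] [CommRing S] [Algebra k S]
  [Fintype n] [DecidableEq n]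

/-- The extension of scalars of a matrix representation from `k` to `S`. -/
noncomputable def repBaseChange (S : Type*) [CommRing S] [Algebra k S]
    (ρ : R →ₐ[k] Matrix n n k) : R →ₐ[k] Matrix n n S :=
  (Algebra.ofId k S).mapMatrix.comp ρ

theorem repBaseChange_self (ρ : R →ₐ[k] Matrix n n k) : repBaseChange k ρ = ρ :=
  AlgHom.ext fun _ => rfl

theorem mapMatrix_comp_repBaseChange {S' : Type*} [CommRing S'] [Algebra k S'] (f : S →ₐ[k] S')
    (ρ : R →ₐ[k] Matrix n n k) : f.mapMatrix.comp (repBaseChange S ρ) = repBaseChange S' ρ :=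
  AlgHom.ext fun r => Matrix.ext fun i j => f.commutes (ρ r i j)

theorem mapMatrix_smul {S' : Type*} [CommRing S'] [Algebra k S'] (f : S →ₐ[k] S') (s : S)
    (A : Matrix n n S) : f.mapMatrix (s • A) = f s • f.mapMatrix A :=
  Matrix.ext fun i j => map_mul f s (A i j)

end BaseChange

theorem isGradable_of_isTwistIntertwiner_lsmul {k R M : Type*} [Field k] [IsAlgClosed k] [Ring R]
    [Algebra k R] [Algebra.FiniteType k R] (𝒜 : ℤ → Submodule k R) [GradedAlgebra 𝒜]
    [AddCommGroup M] [Module k M] [Module R M] [IsScalarTower k R M] [FiniteDimensional k M]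
    (h : ∀ L : ℕ, ∃ (t : kˣ) (g : (Module.End k M)ˣ),
      (∀ n, 0 < n → n ≤ L → t ^ n ≠ 1) ∧ IsTwistIntertwiner 𝒜 t (Algebra.lsmul k k M) g.val) :
    IsGradable 𝒜 M := by
  obtain ⟨s, hs⟩ := Algebra.FiniteType.out (R := k) (A := R)
  obtain ⟨N, hN⟩ := exists_degree_bound 𝒜 s
  obtain ⟨t, g, ht, hg⟩ := h ((Module.finrank k M + 1) * N)
  obtain ⟨φ, hφ⟩ := exists_eigenvalue_position ht g
  let E : k → Submodule k M := g.val.maxGenEigenspace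
  let ℳ : ℤ → Submodule k M := fun j => ⨆ μ ∈ φ ⁻¹' {j}, E μ
  refine ⟨ℳ, isInternal_iSup_maxGenEigenspace_fiber g.val φ,
    smul_mem_of_generators 𝒜 hs ℳ fun r hr i j m hm => ?_⟩
  obtain ⟨a, ha, hai⟩ : ∃ a : R, a = DirectSum.decompose 𝒜 r i ∧ a ∈ 𝒜 i :=
    ⟨_, rfl, SetLike.coe_mem _⟩
  rw [← ha]
  suffices ℳ j ≤ (ℳ (i + j)).comap (Algebra.lsmul k k M a) from this hm
  refine iSup₂_le fun μ hμ m hm => ?_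
  change a • m ∈ ℳ (i + j)
  by_cases ham : a • m = 0
  · exact ham ▸ zero_mem _
  have ham' : a • m ∈ E (t ^ i • μ) :=
    mapsTo_maxGenEigenspace_of_mul_eq_smul_mul (hg hai) μ hm
  have hi : |i| ≤ N := hN r hr i (ha ▸ left_ne_zero_of_smul ham)
  have hpos : φ (t ^ i • μ) = i + j := by
    rw [hφ i μ hi ((E μ).ne_bot_iff.mpr ⟨m, hm, right_ne_zero_of_smul ham⟩)
      ((E _).ne_bot_iff.mpr ⟨a • m, ham', ham⟩), hμ, add_comm]
  exact le_iSup₂_of_le (f := fun ν (_ : ν ∈ φ ⁻¹' {i + j}) => E ν) (t ^ i • μ) hpos le_rfl ham'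

theorem toMatrixAlgEquiv_symm_comp_modulePoint_rep (k R M : Type*) [Field k] [Ring R]
    [Algebra k R] [AddCommGroup M] [Module k M] [Module R M] [IsScalarTower k R M]
    [FiniteDimensional k M] :
    (LinearMap.toMatrixAlgEquiv (Module.finBasis k M)).symm.toAlgHom.comp
      (modulePoint k R M).rep = Algebra.lsmul k k M :=
  AlgHom.ext fun r =>
    (LinearMap.toMatrixAlgEquiv (Module.finBasis k M)).symm_apply_apply (Algebra.lsmul k k M r)

theorem isGradable_of_isTwistIntertwiner {k R M : Type*} [Field k] [IsAlgClosed k] [Ring R]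
    [Algebra k R] [Algebra.FiniteType k R] (𝒜 : ℤ → Submodule k R) [GradedAlgebra 𝒜]
    [AddCommGroup M] [Module k M] [Module R M] [IsScalarTower k R M] [FiniteDimensional k M]
    (h : ∀ L : ℕ, ∃ (t : kˣ) (g : GL (Fin (Module.finrank k M)) k),
      (∀ n, 0 < n → n ≤ L → t ^ n ≠ 1) ∧
      IsTwistIntertwiner 𝒜 t (modulePoint k R M).rep g.val) :
    IsGradable 𝒜 M := by
  let e := LinearMap.toMatrixAlgEquiv (Module.finBasis k M)
  refine isGradable_of_isTwistIntertwiner_lsmul 𝒜 fun L => ?_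
  obtain ⟨t, g, ht, hg⟩ := h L
  refine ⟨t, Units.map e.symm g, ht, ?_⟩
  rw [← toMatrixAlgEquiv_symm_comp_modulePoint_rep]
  exact hg.map (φ := MonoidHom.id k) (map_smul e.symm)

section OpenOrbit

theorem eventually_laurentPolynomial_eval_ne_zero {k : Type*} [CommRing k] [IsDomain k]
    {q : LaurentPolynomial k} (hq : q ≠ 0) :
    ∀ᶠ t : kˣ in Filter.cofinite, LaurentPolynomial.eval₂ (RingHom.id k) t q ≠ 0 := by
  obtain ⟨n, p, hp⟩ := q.exists_T_pow
  have hp0 : p ≠ 0 := by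
    rintro rfl
    rw [map_zero, eq_comm, (LaurentPolynomial.isUnit_T n).mul_left_eq_zero] at hp
    exact hq hp
  refine ((Polynomial.finite_setOfPred_isRoot hp0).preimage Units.val_injective.injOn).subset ?_
  intro t ht
  have ht : LaurentPolynomial.eval₂ (RingHom.id k) t q = 0 := not_not.mp ht
  change p.eval t.val = 0
  rw [← Polynomial.eval₂_id, ← LaurentPolynomial.eval₂_toLaurent, hp, map_mul, ht, zero_mul]

variable {k R : Type*} [Field k] [Ring R] [Algebra k R] (𝒜 : ℤ → Submodule k R)
  [GradedAlgebra 𝒜] {d : ℕ}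

/-- The point of the module variety given by the twist by a unit: the curve `t ↦ x.twist 𝒜 t`
passes through `x` at `t = 1`. -/
noncomputable def ModuleVariety.twist (x : ModuleVariety k R d) (t : kˣ) : ModuleVariety k R d :=
  ⟨gradedTwist 𝒜 t x.rep⟩

theorem ModuleVariety.twist_one (x : ModuleVariety k R d) : x.twist 𝒜 1 = x := by
  rw [twist, gradedTwist_one]

/-- The Laurent polynomials in `t` that give the coordinates of `x.twist 𝒜 t`. -/
noncomputable def ModuleVariety.twistCoords (x : ModuleVariety k R d) :
    R × Fin d × Fin d → LaurentPolynomial k :=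
  let T : (LaurentPolynomial k)ˣ := (LaurentPolynomial.isUnit_T 1).unit
  fun e => gradedTwist 𝒜 T (repBaseChange (LaurentPolynomial k) x.rep) e.1 e.2.1 e.2.2

theorem ModuleVariety.eval_coords_twist (x : ModuleVariety k R d) (t : kˣ)
    (p : MvPolynomial (R × Fin d × Fin d) k) :
    MvPolynomial.eval (x.twist 𝒜 t).coords p =
      LaurentPolynomial.eval₂ (RingHom.id k) t (MvPolynomial.aeval (x.twistCoords 𝒜) p) := by
  let evalT : LaurentPolynomial k →ₐ[k] k :=
    { LaurentPolynomial.eval₂ (RingHom.id k) t with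
      commutes' := LaurentPolynomial.eval₂_C (RingHom.id k) t }
  have hT : Units.map (evalT : LaurentPolynomial k →* k) (LaurentPolynomial.isUnit_T 1).unit = t :=
    Units.ext ((LaurentPolynomial.eval₂_T _ t 1).trans (by rw [zpow_one]))
  have hcoords : (fun e => evalT (x.twistCoords 𝒜 e)) = (x.twist 𝒜 t).coords := by
    funext e
    have hrep := comp_gradedTwist 𝒜 (φ := (evalT : LaurentPolynomial k →* k))
      (t := (LaurentPolynomial.isUnit_T 1).unit)
      (σ := repBaseChange (LaurentPolynomial k) x.rep) (mapMatrix_smul evalT)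
    rw [hT, mapMatrix_comp_repBaseChange, repBaseChange_self] at hrep
    exact congrFun (congrFun (DFunLike.congr_fun hrep e.1) e.2.1) e.2.2
  rw [← hcoords]
  exact (MvPolynomial.comp_aeval_apply _ evalT p).symm

theorem ModuleVariety.tendsto_twist (x : ModuleVariety k R d) :
    Filter.Tendsto (x.twist 𝒜) Filter.cofinite (nhds x) := by
  let := zariskiTopology k (R × Fin d × Fin d)
  rw [nhds_induced ModuleVariety.coords, Filter.tendsto_comap_iff]
  refine TopologicalSpace.tendsto_nhds_generateFrom_iff.mpr ?_
  rintro _ ⟨p, rfl⟩ hx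
  have hne : MvPolynomial.aeval (x.twistCoords 𝒜) p ≠ 0 := by
    intro hzero
    refine hx ?_
    rw [← x.twist_one 𝒜, eval_coords_twist, hzero, map_zero]
  filter_upwards [eventually_laurentPolynomial_eval_ne_zero hne] with t ht
  rwa [← eval_coords_twist] at ht

theorem ModuleVariety.isTwistIntertwiner_of_smul_eq_twist {x : ModuleVariety k R d}
    {g : GL (Fin d) k} {t : kˣ} (h : g • x = x.twist 𝒜 t) :
    IsTwistIntertwiner 𝒜 t x.rep g.val :=
  isTwistIntertwiner_of_gradedTwist fun r => by
    have hr : g.val * x.rep r * g⁻¹.val = gradedTwist 𝒜 t x.rep r := congrArg (rep · r) h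
    rw [← hr, mul_assoc _ _ g.val, Units.inv_mul, mul_one]

theorem eventually_pow_ne_one {k : Type*} [CommRing k] [IsDomain k] (L : ℕ) :
    ∀ᶠ t : kˣ in Filter.cofinite, ∀ n, 0 < n → n ≤ L → t ^ n ≠ 1 := by
  have hpow : ∀ n ∈ Finset.Icc 1 L, ∀ᶠ t : kˣ in Filter.cofinite, t ^ n ≠ 1 := by
    intro n hn
    have : NeZero n := ⟨Nat.one_le_iff_ne_zero.mp (Finset.mem_Icc.mp hn).1⟩
    have hfin : (rootsOfUnity n k : Set kˣ).Finite :=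
      Set.finite_coe_iff.mp (inferInstanceAs (Finite (rootsOfUnity n k)))
    refine hfin.subset fun t ht => ?_
    exact (mem_rootsOfUnity n t).mpr (not_not.mp ht)
  filter_upwards [(Filter.eventually_all_finset _).mpr hpow] with t ht n hn hnL
  exact ht n (Finset.mem_Icc.mpr ⟨hn, hnL⟩)

theorem infinite_units {k : Type*} [Field k] [Infinite k] : Infinite kˣ :=
  have := (Set.finite_singleton (0 : k)).infinite_compl.to_subtype
  unitsEquivNeZero.infinite_iff.mpr this

theorem HasOpenOrbit.isGradable [IsAlgClosed k] [Algebra.FiniteType k R] {M : Type*}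
    [AddCommGroup M] [Module k M] [Module R M] [IsScalarTower k R M] [FiniteDimensional k M]
    (h : HasOpenOrbit k R M) : IsGradable 𝒜 M := by
  have : Infinite kˣ := infinite_units
  refine isGradable_of_isTwistIntertwiner 𝒜 fun L => ?_
  have horbit : ∀ᶠ t in Filter.cofinite, (modulePoint k R M).twist 𝒜 t ∈
      MulAction.orbit (GL (Fin (Module.finrank k M)) k) (modulePoint k R M) :=
    (modulePoint k R M).tendsto_twist 𝒜 (h.mem_nhds (MulAction.mem_orbit_self _))
  obtain ⟨t, ⟨g, hg⟩, ht⟩ := (horbit.and (eventually_pow_ne_one L)).exists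
  exact ⟨t, g, ht, ModuleVariety.isTwistIntertwiner_of_smul_eq_twist 𝒜 hg⟩

end OpenOrbit

section Derivations

variable {k R A : Type*} [CommRing k] [Ring R] [Algebra k R] [Ring A] [Algebra k A]

/-- `D` is a derivation from `R` to `A`, where `A` is the `R`-bimodule given by `ρ`. Mathlib's
`Derivation` is restricted to commutative `R`. -/
def IsDerivationAlong (ρ : R →ₐ[k] A) (D : R →ₗ[k] A) : Prop :=
  ∀ r s, D (r * s) = D r * ρ s + ρ r * D s

/-- The first Hochschild cohomology of `R` with coefficients in `A`, a bimodule through `ρ`,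
vanishes: every derivation along `ρ` is a commutator with an element of `A`. -/
def AllDerivationsInner (ρ : R →ₐ[k] A) : Prop :=
  ∀ D : R →ₗ[k] A, IsDerivationAlong ρ D → ∃ a, ∀ r, D r = a * ρ r - ρ r * a

theorem IsDerivationAlong.map_algebraMap {ρ : R →ₐ[k] A} {D : R →ₗ[k] A}
    (hD : IsDerivationAlong ρ D) (c : k) : D (algebraMap k R c) = 0 := by
  have hD1 : D 1 = 0 := by simpa using hD 1 1
  rw [Algebra.algebraMap_eq_smul_one, map_smul, hD1, smul_zero]

theorem AllDerivationsInner.of_algEquiv_comp {A' : Type*} [Ring A'] [Algebra k A']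
    {ρ : R →ₐ[k] A} (e : A ≃ₐ[k] A') (h : AllDerivationsInner (e.toAlgHom.comp ρ)) :
    AllDerivationsInner ρ := by
  intro D hD
  obtain ⟨a, ha⟩ := h (e.toLinearMap ∘ₗ D) fun r s => by simp [hD r s]
  refine ⟨e.symm a, fun r => e.injective ?_⟩
  simpa using ha r

end Derivations

section DerivationExtension

variable {k : Type w} {R : Type u} {M : Type v} [CommRing k] [Ring R] [Algebra k R]
  [AddCommGroup M] [Module k M] [Module R M] [IsScalarTower k R M] {D : R →ₗ[k] Module.End k M}

/-- The extension of `M` by itself given by a derivation `D` from `R` to `End M`: the abelian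
group `M × M` with `r • (x, y) = (r • x + D r y, r • y)`. The derivation property is an argument
so that the module structure can be an instance. -/
def DerivationExtension (_ : IsDerivationAlong (Algebra.lsmul k k M) D) : Type v :=
  M × M

namespace DerivationExtension

variable (hD : IsDerivationAlong (Algebra.lsmul k k M) D)

instance : AddCommGroup (DerivationExtension hD) := inferInstanceAs (AddCommGroup (M × M))

instance : Module R (DerivationExtension hD) where
  smul r x := ((r • x.1 + D r x.2, r • x.2) : M × M)
  one_smul x := by
    refine Prod.ext ?_ (one_smul R x.2)
    have hD1 : D 1 = 0 := by simpa using hD.map_algebraMap 1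
    change (1 : R) • x.1 + D 1 x.2 = x.1
    rw [hD1, one_smul, LinearMap.zero_apply, add_zero]
  mul_smul r s x := by
    refine Prod.ext ?_ (mul_smul r s x.2)
    change (r * s) • x.1 + D (r * s) x.2 = r • (s • x.1 + D s x.2) + D r (s • x.2)
    simp only [hD r s, smul_add, mul_smul, LinearMap.add_apply, Module.End.mul_apply,
      Algebra.lsmul_coe]
    abel
  smul_zero r := by
    refine Prod.ext ?_ (smul_zero r)
    change r • (0 : M) + D r 0 = 0
    rw [smul_zero, map_zero, add_zero]
  smul_add r x y := by
    refine Prod.ext ?_ (smul_add r x.2 y.2)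
    change r • (x.1 + y.1) + D r (x.2 + y.2) = (r • x.1 + D r x.2) + (r • y.1 + D r y.2)
    rw [smul_add, map_add, add_add_add_comm]
  add_smul r s x := by
    refine Prod.ext ?_ (add_smul r s x.2)
    change (r + s) • x.1 + D (r + s) x.2 = (r • x.1 + D r x.2) + (s • x.1 + D s x.2)
    rw [add_smul, map_add, LinearMap.add_apply, add_add_add_comm]
  zero_smul x := by
    refine Prod.ext ?_ (zero_smul R x.2)
    change (0 : R) • x.1 + D 0 x.2 = 0
    rw [zero_smul, map_zero, LinearMap.zero_apply, add_zero]

/-- The inclusion of `M` as the submodule of the extension. -/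
def incl : M →ₗ[R] DerivationExtension hD where
  toFun x := ((x, 0) : M × M)
  map_add' x y := Prod.ext rfl (add_zero (0 : M)).symm
  map_smul' r x := by
    refine Prod.ext ?_ (smul_zero r).symm
    change r • x = r • x + D r 0
    rw [map_zero, add_zero]

/-- The projection of the extension onto its quotient module `M`. -/
def proj : DerivationExtension hD →ₗ[R] M where
  toFun x := x.2
  map_add' _ _ := rfl
  map_smul' _ _ := rfl

/-- The extension as a short complex `M ⟶ DerivationExtension hD ⟶ M`. -/
noncomputable def shortComplex : ShortComplex (ModuleCat.{v} R) :=
  ShortComplex.mk (ModuleCat.ofHom (incl hD)) (ModuleCat.ofHom (proj hD)) rfl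

theorem shortExact : (shortComplex hD).ShortExact where
  exact := by
    rw [ShortComplex.ShortExact.moduleCat_exact_iff_function_exact]
    intro x
    constructor
    · intro hx
      exact ⟨x.1, Prod.ext rfl (Eq.symm hx)⟩
    · rintro ⟨y, rfl⟩
      rfl
  mono_f := (ModuleCat.mono_iff_injective _).mpr fun _ _ h => congrArg Prod.fst h
  epi_g := (ModuleCat.epi_iff_surjective _).mpr fun y => ⟨((0, y) : M × M), rfl⟩

variable {hD}

/-- A section has the form `m ↦ (a m, m)`, and its `R`-linearity says that `D` is the commutator
with `a`. -/
theorem exists_commutator_of_section (σ : M →ₗ[R] DerivationExtension hD)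
    (hσ : proj hD ∘ₗ σ = LinearMap.id) :
    ∃ a : Module.End k M, ∀ r, D r = a * Algebra.lsmul k k M r - Algebra.lsmul k k M r * a := by
  have hsnd (m : M) : (σ m).2 = m := LinearMap.congr_fun hσ m
  have hfst (r : R) (m : M) : (σ (r • m)).1 = r • (σ m).1 + D r m := by
    have hσr : (σ (r • m)).1 = r • (σ m).1 + D r (σ m).2 := congrArg Prod.fst (σ.map_smul r m)
    rwa [hsnd] at hσr
  let a : Module.End k M :=
    { toFun := fun m => (σ m).1
      map_add' := fun x y => congrArg Prod.fst (σ.map_add x y)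
      map_smul' := fun c m => by
        simpa [hD.map_algebraMap] using hfst (algebraMap k R c) m }
  exact ⟨a, fun r => LinearMap.ext fun m =>
    eq_sub_of_add_eq ((add_comm _ _).trans (hfst r m).symm)⟩

end DerivationExtension

theorem exists_section_of_subsingleton_ext [Small.{v} R] {S : ShortComplex (ModuleCat.{v} R)}
    (hS : S.ShortExact) (h : Subsingleton (Abelian.Ext.{v} S.X₃ S.X₁ 1)) :
    ∃ s : S.X₃ ⟶ S.X₂, s ≫ S.g = 𝟙 S.X₃ := by
  obtain ⟨x, hx⟩ := Abelian.Ext.covariant_sequence_exact₃ S.X₃ hS (Abelian.Ext.mk₀ (𝟙 S.X₃))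
    (zero_add 1) (h.elim _ _)
  obtain ⟨s, rfl⟩ := (Abelian.Ext.mk₀_bijective _ _).2 x
  rw [Abelian.Ext.mk₀_comp_mk₀] at hx
  exact ⟨s, (Abelian.Ext.mk₀_bijective _ _).1 hx⟩

theorem allDerivationsInner_lsmul_of_subsingleton_ext [Small.{v} R]
    (h : Subsingleton (Abelian.Ext.{v} (ModuleCat.of R M) (ModuleCat.of R M) 1)) :
    AllDerivationsInner (Algebra.lsmul k k M : R →ₐ[k] Module.End k M) := by
  intro D hD
  obtain ⟨s, hs⟩ := exists_section_of_subsingleton_ext (DerivationExtension.shortExact hD) h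
  exact DerivationExtension.exists_commutator_of_section s.hom (congrArg ModuleCat.Hom.hom hs)

end DerivationExtension

section FormalRigidity

open PowerSeries

section Adic

variable {A : Type*} [Ring A]

theorem X_pow_dvd_mul_left {n : ℕ} {φ : A⟦X⟧} (h : X ^ n ∣ φ) (ψ : A⟦X⟧) : X ^ n ∣ ψ * φ := by
  obtain ⟨χ, rfl⟩ := h
  exact ⟨ψ * χ, by rw [← mul_assoc, ← mul_assoc, X_pow_mul]⟩

theorem coeff_mul_of_X_pow_dvd_right {n : ℕ} {ψ : A⟦X⟧} (h : X ^ n ∣ ψ) (φ : A⟦X⟧) :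
    coeff n (φ * ψ) = constantCoeff φ * coeff n ψ := by
  obtain ⟨χ, rfl⟩ := h
  have hcoeff (ω : A⟦X⟧) : coeff n (X ^ n * ω) = constantCoeff ω := by
    simpa using coeff_X_pow_mul ω n 0
  rw [← mul_assoc, ← X_pow_mul, mul_assoc, hcoeff, hcoeff, map_mul]

theorem X_pow_succ_dvd_iff {n : ℕ} {φ : A⟦X⟧} :
    X ^ (n + 1) ∣ φ ↔ X ^ n ∣ φ ∧ coeff n φ = 0 := by
  simp only [X_pow_dvd_iff, Nat.lt_succ_iff_lt_or_eq, or_imp, forall_and, forall_eq]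

theorem eq_zero_of_forall_X_pow_dvd {φ : A⟦X⟧} (h : ∀ n, X ^ (n + 1) ∣ φ) : φ = 0 :=
  PowerSeries.ext fun n => (X_pow_succ_dvd_iff.mp (h n)).2

theorem exists_forall_X_pow_dvd_sub {g : ℕ → A⟦X⟧} (h : ∀ n, X ^ (n + 1) ∣ g (n + 1) - g n) :
    ∃ G : A⟦X⟧, ∀ n, X ^ (n + 1) ∣ G - g n := by
  have hstable (m n : ℕ) (hmn : m ≤ n) : coeff m (g n) = coeff m (g m) := by
    induction n, hmn using Nat.le_induction with
    | base => rfl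
    | succ n hmn ih =>
      rw [← ih, ← sub_eq_zero, ← map_sub]
      exact X_pow_dvd_iff.mp (h n) m (Nat.lt_succ_of_le hmn)
  refine ⟨PowerSeries.mk fun m => coeff m (g m), fun n => X_pow_dvd_iff.mpr fun m hm => ?_⟩
  rw [map_sub, coeff_mk, hstable m n (Nat.le_of_lt_succ hm), sub_self]

end Adic

variable {k R A : Type*} [CommRing k] [Ring R] [Algebra k R] [Ring A] [Algebra k A]
  {ρ : R →ₐ[k] A} {τ : R →ₐ[k] A⟦X⟧}

/-- The failure of `g` to conjugate the constant family `ρ` into the family `τ`. -/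
noncomputable def conjugationDefect (ρ : R →ₐ[k] A) (τ : R →ₐ[k] A⟦X⟧) (g : A⟦X⟧) :
    R →ₗ[k] A⟦X⟧ where
  toFun r := τ r * g - g * C (ρ r)
  map_add' r s := by simp only [map_add, add_mul, mul_add, add_sub_add_comm]
  map_smul' c r := by
    have hC : C (c • ρ r) = c • C (ρ r) := by
      simpa only [monomial_zero_eq_C] using (monomial 0).map_smul_of_tower c (ρ r)
    simp only [map_smul, hC, smul_mul_assoc, mul_smul_comm, smul_sub, RingHom.id_apply]

theorem conjugationDefect_apply (g : A⟦X⟧) (r : R) :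
    conjugationDefect ρ τ g r = τ r * g - g * C (ρ r) := rfl

theorem conjugationDefect_add (g h : A⟦X⟧) (r : R) : conjugationDefect ρ τ (g + h) r =
    conjugationDefect ρ τ g r + conjugationDefect ρ τ h r := by
  simp only [conjugationDefect_apply, mul_add, add_mul, add_sub_add_comm]

theorem conjugationDefect_mul (g : A⟦X⟧) (r s : R) : conjugationDefect ρ τ g (r * s) =
    conjugationDefect ρ τ g r * C (ρ s) + τ r * conjugationDefect ρ τ g s := by
  simp only [conjugationDefect_apply, map_mul]
  noncomm_ring

theorem X_pow_dvd_conjugationDefect {n : ℕ} {g : A⟦X⟧} (h : X ^ n ∣ g) (r : R) :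
    X ^ n ∣ conjugationDefect ρ τ g r :=
  dvd_sub (X_pow_dvd_mul_left h _) (h.mul_right _)

theorem coeff_conjugationDefect_of_X_pow_dvd (hτ : ∀ r, constantCoeff (τ r) = ρ r) {n : ℕ}
    {g : A⟦X⟧} (h : X ^ n ∣ g) (r : R) :
    coeff n (conjugationDefect ρ τ g r) = ρ r * coeff n g - coeff n g * ρ r := by
  rw [conjugationDefect_apply, map_sub, coeff_mul_of_X_pow_dvd_right h, hτ, coeff_mul_C]

theorem isDerivationAlong_coeff_conjugationDefect (hτ : ∀ r, constantCoeff (τ r) = ρ r) {n : ℕ}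
    {g : A⟦X⟧} (h : ∀ r, X ^ n ∣ conjugationDefect ρ τ g r) :
    IsDerivationAlong ρ ((coeff n).restrictScalars k ∘ₗ conjugationDefect ρ τ g) := by
  intro r s
  simp only [LinearMap.comp_apply, LinearMap.restrictScalars_apply]
  rw [conjugationDefect_mul, map_add, coeff_mul_C, coeff_mul_of_X_pow_dvd_right (h s), hτ]

theorem exists_X_pow_succ_dvd_conjugationDefect (hρ : AllDerivationsInner ρ)
    (hτ : ∀ r, constantCoeff (τ r) = ρ r) {n : ℕ} {g : A⟦X⟧}
    (h : ∀ r, X ^ n ∣ conjugationDefect ρ τ g r) :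
    ∃ g', X ^ n ∣ g' - g ∧ ∀ r, X ^ (n + 1) ∣ conjugationDefect ρ τ g' r := by
  obtain ⟨a, ha⟩ := hρ _ (isDerivationAlong_coeff_conjugationDefect hτ h)
  have ha (r : R) : coeff n (conjugationDefect ρ τ g r) = a * ρ r - ρ r * a := ha r
  have hdvd : X ^ n ∣ monomial n a :=
    X_pow_dvd_iff.mpr fun m hm => by rw [coeff_monomial, if_neg hm.ne]
  refine ⟨g + monomial n a, by rwa [add_sub_cancel_left], fun r => X_pow_succ_dvd_iff.mpr ⟨?_, ?_⟩⟩
  · rw [conjugationDefect_add]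
    exact dvd_add (h r) (X_pow_dvd_conjugationDefect hdvd r)
  · rw [conjugationDefect_add, map_add, ha, coeff_conjugationDefect_of_X_pow_dvd hτ hdvd,
      coeff_monomial_same, sub_add_sub_cancel, sub_self]

theorem exists_conjugating_series (hρ : AllDerivationsInner ρ)
    (hτ : ∀ r, constantCoeff (τ r) = ρ r) :
    ∃ g : A⟦X⟧, constantCoeff g = 1 ∧ ∀ r, g * C (ρ r) = τ r * g := by
  have hone (r : R) : X ^ 1 ∣ conjugationDefect ρ τ 1 r := by
    rw [pow_one, X_dvd_iff, conjugationDefect_apply, mul_one, one_mul, map_sub, hτ,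
      constantCoeff_C, sub_self]
  choose! next hnext_sub hnext using fun n g h =>
    exists_X_pow_succ_dvd_conjugationDefect (n := n + 1) (g := g) hρ hτ h
  let approx : ℕ → A⟦X⟧ := fun n => Nat.rec 1 next n
  have happrox (n : ℕ) : ∀ r, X ^ (n + 1) ∣ conjugationDefect ρ τ (approx n) r := by
    induction n with
    | zero => exact hone
    | succ n ih => exact hnext n _ ih
  obtain ⟨g, hg⟩ := exists_forall_X_pow_dvd_sub (g := approx) fun n => hnext_sub n _ (happrox n)
  refine ⟨g, ?_, fun r => ?_⟩
  · have hdvd : X ^ 1 ∣ g - 1 := hg 0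
    rwa [pow_one, X_dvd_iff, map_sub, map_one, sub_eq_zero] at hdvd
  · refine (sub_eq_zero.mp (eq_zero_of_forall_X_pow_dvd fun n => ?_)).symm
    rw [← conjugationDefect_apply, ← add_sub_cancel (approx n) g, conjugationDefect_add]
    exact dvd_add (happrox n r) (X_pow_dvd_conjugationDefect (hg n) r)

end FormalRigidity

section MatrixPowerSeries

open PowerSeries

/-- A matrix of power series, read as a power series with matrix coefficients. -/
noncomputable def matrixPowerSeriesEquiv (k n : Type*) [CommRing k] [Fintype n] [DecidableEq n] :
    Matrix n n k⟦X⟧ ≃ₐ[k] (Matrix n n k)⟦X⟧ where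
  toFun P := PowerSeries.mk fun m => P.map (coeff m)
  invFun Q := Matrix.of fun i j => PowerSeries.mk fun m => coeff m Q i j
  left_inv P := by ext; simp
  right_inv Q := by ext; simp
  map_add' P Q := by ext; simp
  map_mul' P Q := by
    ext m i j
    simp only [coeff_mk, coeff_mul, Matrix.map_apply, Matrix.mul_apply, map_sum, Matrix.sum_apply]
    exact Finset.sum_comm
  commutes' c := by
    ext m i j
    rw [PowerSeries.algebraMap_apply, coeff_C, coeff_mk, Matrix.map_apply]
    rcases eq_or_ne m 0 with rfl | hm <;> rcases eq_or_ne i j with rfl | hij <;>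
      simp [Matrix.algebraMap_matrix_apply, coeff_C, *]

variable {k R n : Type*} [CommRing k] [Ring R] [Algebra k R] [Fintype n] [DecidableEq n]

theorem coeff_matrixPowerSeriesEquiv (m : ℕ) (P : Matrix n n k⟦X⟧) :
    coeff m (matrixPowerSeriesEquiv k n P) = P.map (coeff m) :=
  coeff_mk m fun m => P.map (coeff m)

theorem constantCoeff_matrixPowerSeriesEquiv (P : Matrix n n k⟦X⟧) :
    constantCoeff (matrixPowerSeriesEquiv k n P) = P.map constantCoeff := by
  rw [← coeff_zero_eq_constantCoeff, ← coeff_zero_eq_constantCoeff, coeff_matrixPowerSeriesEquiv]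

theorem matrixPowerSeriesEquiv_repBaseChange (ρ : R →ₐ[k] Matrix n n k) (r : R) :
    matrixPowerSeriesEquiv k n (repBaseChange k⟦X⟧ ρ r) = C (ρ r) := by
  ext m i j
  rw [coeff_matrixPowerSeriesEquiv]
  change coeff m (C (ρ r i j)) = coeff m (C (ρ r)) i j
  rw [coeff_C, coeff_C]
  split_ifs <;> rfl

theorem isUnit_of_map_constantCoeff_eq_one {P : Matrix n n k⟦X⟧} (h : P.map constantCoeff = 1) :
    IsUnit P := by
  rw [Matrix.isUnit_iff_isUnit_det, isUnit_iff_constantCoeff, RingHom.map_det]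
  exact (congrArg Matrix.det h).trans Matrix.det_one ▸ isUnit_one

theorem exists_isTwistIntertwiner_powerSeries (𝒜 : ℤ → Submodule k R) [GradedAlgebra 𝒜]
    {ρ : R →ₐ[k] Matrix n n k} (hρ : AllDerivationsInner ρ) {u : k⟦X⟧ˣ}
    (hu : constantCoeff u.val = 1) :
    ∃ g : GL n k⟦X⟧, IsTwistIntertwiner 𝒜 u (repBaseChange k⟦X⟧ ρ) g.val := by
  let e := matrixPowerSeriesEquiv k n
  let twisted := gradedTwist 𝒜 u (repBaseChange k⟦X⟧ ρ)
  have hconst (r : R) : constantCoeff (e (twisted r)) = ρ r := by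
    let ε : k⟦X⟧ →ₐ[k] k := { constantCoeff with commutes' := constantCoeff_C }
    have hεu : Units.map (ε : k⟦X⟧ →* k) u = 1 := Units.ext hu
    have hcomp := comp_gradedTwist 𝒜 (φ := (ε : k⟦X⟧ →* k)) (t := u)
      (σ := repBaseChange k⟦X⟧ ρ) (mapMatrix_smul ε)
    rw [hεu, gradedTwist_one, mapMatrix_comp_repBaseChange, repBaseChange_self] at hcomp
    exact (constantCoeff_matrixPowerSeriesEquiv _).trans (DFunLike.congr_fun hcomp r)
  obtain ⟨G, hG1, hG⟩ := exists_conjugating_series hρ (τ := e.toAlgHom.comp twisted) hconst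
  have hunit : IsUnit (e.symm G) := isUnit_of_map_constantCoeff_eq_one (by
    rw [← constantCoeff_matrixPowerSeriesEquiv, ← hG1]
    exact congrArg constantCoeff (e.apply_symm_apply G))
  refine ⟨hunit.unit, isTwistIntertwiner_of_gradedTwist fun r => e.injective ?_⟩
  rw [IsUnit.unit_spec, map_mul, map_mul, e.apply_symm_apply,
    matrixPowerSeriesEquiv_repBaseChange]
  exact hG r

theorem exists_powerSeries_unit_pow_ne_one (k : Type*) [CommRing k] [Nontrivial k] :
    ∃ u : k⟦X⟧ˣ, constantCoeff u.val = 1 ∧ ∀ n, 0 < n → u ^ n ≠ 1 := by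
  have hconst : constantCoeff (1 + X : k⟦X⟧) = 1 := by simp
  obtain ⟨u, hu⟩ : IsUnit (1 + X : k⟦X⟧) := isUnit_iff_constantCoeff.mpr (hconst ▸ isUnit_one)
  refine ⟨u, hu ▸ hconst, fun n hn h => ?_⟩
  have hcoeff : coeff n (((1 + Polynomial.X) ^ n : Polynomial k) : k⟦X⟧) = 1 := by
    rw [Polynomial.coeff_coe, Polynomial.coeff_one_add_X_pow, Nat.choose_self, Nat.cast_one]
  rw [Polynomial.coe_pow, Polynomial.coe_add, Polynomial.coe_one, Polynomial.coe_X, ← hu,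
    ← Units.val_pow_eq_pow_val, h, Units.val_one, coeff_one, if_neg hn.ne'] at hcoeff
  exact zero_ne_one hcoeff

end MatrixPowerSeries

section Specialization

variable {k : Type*} [Field k]

theorem exists_algHom_apply_ne_zero [IsAlgClosed k] {B : Type*} [CommRing B] [IsReduced B]
    [Algebra k B] [Algebra.FiniteType k B] {b : B} (hb : b ≠ 0) : ∃ φ : B →ₐ[k] k, φ b ≠ 0 := by
  have := isJacobsonRing_of_finiteType (A := k) (B := B)
  have hjac : (⊥ : Ideal B).jacobson = ⊥ := IsJacobsonRing.out this Ideal.isRadical_bot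
  obtain ⟨m, hm, hbm⟩ : ∃ m : Ideal B, m.IsMaximal ∧ b ∉ m := by
    contrapose! hb
    rw [← Ideal.mem_bot, ← hjac, Ideal.jacobson, Ideal.mem_sInf]
    exact fun {m} hm => hb m hm.2
  let := Ideal.Quotient.field m
  have := finite_of_finite_type_of_isJacobsonRing k (B ⧸ m)
  let e : k ≃ₐ[k] B ⧸ m :=
    AlgEquiv.ofBijective (Algebra.ofId k _) IsAlgClosed.algebraMap_bijective_of_isIntegral
  refine ⟨e.symm.toAlgHom.comp (Ideal.Quotient.mkₐ k m), fun h => hbm ?_⟩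
  exact Ideal.Quotient.eq_zero_iff_mem.mp (e.symm.map_eq_zero_iff.mp h)

theorem exists_units_map_eq {M N : Type*} [Monoid M] [Monoid N] {f : M →* N}
    (hf : Function.Injective f) {u : Nˣ} (hu : u.val ∈ MonoidHom.mrange f)
    (hu' : u⁻¹.val ∈ MonoidHom.mrange f) : ∃ v : Mˣ, Units.map f v = u := by
  obtain ⟨a, ha⟩ := hu
  obtain ⟨b, hb⟩ := hu'
  exact ⟨⟨a, b, hf (by rw [map_mul, ha, hb, Units.mul_inv, map_one]),
    hf (by rw [map_mul, ha, hb, Units.inv_mul, map_one])⟩, Units.ext ha⟩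

theorem exists_fg_subalgebra_units_lift {k S n : Type*} [CommRing k] [CommRing S] [Algebra k S]
    [Fintype n] [DecidableEq n] (t : Sˣ) (g : GL n S) :
    ∃ (B : Subalgebra k S) (s : Bˣ) (h : GL n B), B.FG ∧ Units.map (B.val : B →* S) s = t ∧
      Matrix.GeneralLinearGroup.map (B.val : B →+* S) h = g := by
  let T : Set S := Set.range (fun p : n × n => g.val p.1 p.2) ∪
    Set.range (fun p : n × n => g⁻¹.val p.1 p.2) ∪ {t.val, t⁻¹.val}
  have hT : T.Finite :=
    ((Set.finite_range _).union (Set.finite_range _)).union (Set.toFinite _)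
  have hmem (x : S) (hx : x ∈ T) :
      x ∈ MonoidHom.mrange ((Algebra.adjoin k T).val : Algebra.adjoin k T →* S) :=
    ⟨⟨x, Algebra.subset_adjoin hx⟩, rfl⟩
  obtain ⟨s, hs⟩ := exists_units_map_eq Subtype.val_injective
    (hmem t.val (by simp [T])) (hmem t⁻¹.val (by simp [T]))
  have hentries (A : Matrix n n S) (hA : ∀ i j, A i j ∈ T) :
      A ∈ MonoidHom.mrange ((Algebra.adjoin k T).val.mapMatrix : _ →ₐ[k] Matrix n n S) :=
    ⟨Matrix.of fun i j => ⟨A i j, Algebra.subset_adjoin (hA i j)⟩, rfl⟩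
  obtain ⟨h, hh⟩ := exists_units_map_eq (Matrix.map_injective Subtype.val_injective)
    (hentries g.val fun i j => .inl (.inl ⟨(i, j), rfl⟩))
    (hentries g⁻¹.val fun i j => .inl (.inr ⟨(i, j), rfl⟩))
  exact ⟨Algebra.adjoin k T, s, h, Subalgebra.fg_def.mpr ⟨T, hT, rfl⟩, hs, hh⟩

theorem IsTwistIntertwiner.exists_specialization [IsAlgClosed k] {R S n : Type*} [Ring R]
    [Algebra k R] [CommRing S] [IsDomain S] [Algebra k S] [Fintype n] [DecidableEq n]
    {𝒜 : ℤ → Submodule k R} {ρ : R →ₐ[k] Matrix n n k} {t : Sˣ} {g : GL n S} {L : ℕ}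
    (hg : IsTwistIntertwiner 𝒜 t (repBaseChange S ρ) g.val)
    (ht : ∀ n, 0 < n → n ≤ L → t ^ n ≠ 1) :
    ∃ (t' : kˣ) (g' : GL n k), (∀ n, 0 < n → n ≤ L → t' ^ n ≠ 1) ∧
      IsTwistIntertwiner 𝒜 t' ρ g'.val := by
  obtain ⟨B, s, h, hB, rfl, rfl⟩ := exists_fg_subalgebra_units_lift (k := k) t g
  have : Algebra.FiniteType k B := (Subalgebra.fg_iff_finiteType B).mp hB
  have hh : IsTwistIntertwiner 𝒜 s (repBaseChange B ρ) h.val := by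
    rw [← mapMatrix_comp_repBaseChange B.val] at hg
    exact hg.of_map (mapMatrix_smul B.val) (Matrix.map_injective Subtype.val_injective)
  have hprod : ∏ m ∈ Finset.Icc 1 L, (s.val ^ m - 1) ≠ 0 := by
    refine Finset.prod_ne_zero_iff.mpr fun m hm => sub_ne_zero.mpr fun hs => ?_
    obtain ⟨hm0, hmL⟩ := Finset.mem_Icc.mp hm
    refine ht m hm0 hmL ?_
    have hsm : s ^ m = 1 := Units.ext hs
    rw [← map_pow, hsm, map_one]
  obtain ⟨φ, hφ⟩ := exists_algHom_apply_ne_zero (k := k) hprod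
  refine ⟨Units.map (φ : B →* k) s, Matrix.GeneralLinearGroup.map (φ : B →+* k) h,
    fun m hm0 hmL hs => ?_, ?_⟩
  · rw [map_prod, Finset.prod_ne_zero_iff] at hφ
    refine hφ m (Finset.mem_Icc.mpr ⟨hm0, hmL⟩) ?_
    rw [map_sub, map_pow, map_one, sub_eq_zero]
    exact congrArg Units.val hs
  · have hφh := hh.map (φ := (φ : B →* k)) (mapMatrix_smul φ)
    rwa [mapMatrix_comp_repBaseChange, repBaseChange_self] at hφh

end Specialization

theorem isGradable_of_subsingleton_ext {k : Type w} {R : Type u} {M : Type v} [Field k]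
    [IsAlgClosed k] [Ring R] [Algebra k R] [Algebra.FiniteType k R] (𝒜 : ℤ → Submodule k R)
    [GradedAlgebra 𝒜] [AddCommGroup M] [Module k M] [Module R M] [IsScalarTower k R M]
    [FiniteDimensional k M] [Small.{v} R]
    (h : Subsingleton (Abelian.Ext.{v} (ModuleCat.of R M) (ModuleCat.of R M) 1)) :
    IsGradable 𝒜 M := by
  have hρ : AllDerivationsInner (modulePoint k R M).rep := by
    refine .of_algEquiv_comp (LinearMap.toMatrixAlgEquiv (Module.finBasis k M)).symm ?_
    rw [toMatrixAlgEquiv_symm_comp_modulePoint_rep]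
    exact allDerivationsInner_lsmul_of_subsingleton_ext h
  obtain ⟨u, hu, hu_pow⟩ := exists_powerSeries_unit_pow_ne_one k
  obtain ⟨g, hg⟩ := exists_isTwistIntertwiner_powerSeries 𝒜 hρ hu
  exact isGradable_of_isTwistIntertwiner 𝒜 fun L =>
    hg.exists_specialization fun n hn _ => hu_pow n hn

theorem mainTheorem3 {k : Type w} {R : Type u} {M : Type v} [Field k] [IsAlgClosed k]
    [Ring R] [Algebra k R] [Algebra.FiniteType k R]
    (𝒜 : ℤ → Submodule k R) [GradedAlgebra 𝒜]
    [AddCommGroup M] [Module k M] [Module R M] [IsScalarTower k R M] [FiniteDimensional k M]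
    [Small.{v} R] :
    (HasOpenOrbit k R M → IsGradable 𝒜 M) ∧
      (Subsingleton (Abelian.Ext.{v} (ModuleCat.of R M) (ModuleCat.of R M) 1) →
        IsGradable 𝒜 M) :=
  ⟨HasOpenOrbit.isGradable 𝒜, isGradable_of_subsingleton_ext 𝒜⟩
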